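/- Let $C\ge 1$ be the number of classes, let $\tilde\Delta^{C-1}=\{p\in\mathbb R^{C-1}: p_i\ge 0,\ \sum_{i} p_i\le 1\}$ be the projected probability simplex, and let $$u:\mathbb R^{C-1}\to\tilde\Delta^{C-1},\qquad u(x)=\Bigl(\frac{\exp(x_i)}{1+\sum_{k=1}^{C-1}\exp(x_k)}\Bigr)_{1\le i\le C-1}$$ be the $\mathrm{softmax}^+$ map. Write $s(t)=\log(1+e^t)$, applied elementwise to vectors. A *fully input convex neural network* (FICNN) with $M\ge1$ hidden layers of width $H\ge1$ is a function $g:\mathbb R^{C-1}\to\mathbb R$ of the form $$z_1=l_1^+(x),\qquad z_k=l_k(x)+l_k^+(s(z_{k-1}))\quad(2\le k\le M+1),$$ $$g(x)=s(w_0)\,s(z_{M+1})+s(w_1)\frac{\|x\|^2}{2},$$ where $w_0,w_1\in\mathbb R$, the $l_k$ are affine maps (weights and bias unconstrained), the $l_k^+$ are affine maps with strictly positive weights and unconstrained bias, and $z_k\in\mathbb R^H$ for $k\le M$, $z_{M+1}\in\mathbb R$. Let $\mathcal F$ be the set of all maps $f:\mathbb R^{C-1}\to\tilde\Delta^{C-1}$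 of the form $f=u\circ v^{-1}$ with $$v^{-1}=(\nabla g_1)\circ(\nabla g_2)\circ\dots\circ(\nabla g_B),$$ where $B\ge1$, $H\ge1$, $M\ge1$ are arbitrary and $g_1,\dots,g_B$ are FICNNs with $M$ hidden layers of width $H$. Let $\Omega\subset\mathbb R^{C-1}$ be compact, and let $\mathcal C(\Omega)$ be the set of functions $G$ that are convex and twice differentiable on some convex open set containing $\Omega$ (for instance on $\mathbb R^{C-1}$) and have a positive definite Hessian at every point of $\Omega$. Then $\mathcal F$ is dense, with respect to uniform convergence on $\Omega$, in the gradients of functions in $\mathcal C(\Omega)$ with values in the projected simplex, in the sense that these gradients can be approximated by members of $\mathcal F$: for every $G\in\mathcal C(\Omega)$ with $\nabla G(\Omega)\subseteq\tilde\Delta^{C-1}$ and every $\varepsilon>0$ there is $f\in\mathcal F$ such that $$\|f(x)-\nabla G(x)\|<\varepsilon\qquad\text{for all }x\in\Omega .$$ -/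

import Mathlib

open Set
open scoped Matrix

noncomputable section

namespace LegendreTron

/-- The space `ℝ^(C-1)` with its Euclidean norm, where `n = C - 1` and `C` is the number of
classes. -/
abbrev E (n : ℕ) : Type := EuclideanSpace ℝ (Fin n)

/-- The projected probability simplex: `p ∈ ℝ^n` with `p_i ≥ 0` and `∑ p_i ≤ 1`. -/
def projSimplex (n : ℕ) : Set (E n) := {p | (∀ i, 0 ≤ p i) ∧ ∑ i, p i ≤ 1}

/-- The map `softmax⁺`, `u(x)_i = exp x_i / (1 + ∑_k exp x_k)`. -/
def softmaxPlus {n : ℕ} (x : E n) : E n :=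
  WithLp.toLp 2 fun i => Real.exp (x i) / (1 + ∑ k, Real.exp (x k))

/-- The softplus function `s(t) = log (1 + exp t)`. -/
def softplus (t : ℝ) : ℝ := Real.log (1 + Real.exp t)

/-- A linear layer `x ↦ W x + b` from `ℝ^p` to `ℝ^q`. -/
structure LinearLayer (p q : ℕ) where
  weight : Matrix (Fin q) (Fin p) ℝ
  bias : Fin q → ℝ

/-- The map computed by a linear layer. -/
def LinearLayer.apply {p q : ℕ} (l : LinearLayer p q) (x : Fin p → ℝ) : Fin q → ℝ :=
  l.weight *ᵥ x + l.bias

/-- A linear layer all of whose weights are positive (the bias is unconstrained). -/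
structure PosLinearLayer (p q : ℕ) extends LinearLayer p q where
  weight_pos : ∀ i j, 0 < weight i j

/-- The parameters of a fully input convex neural network on `ℝ^n` with `M = m + 1` hidden layers
of width `H`. Here `posFirst` is `l⁺_1`; `lin k` and `pos k` are `l_(k+2)` and `l⁺_(k+2)` for
`k = 0, …, m - 1`; `linOut` and `posOut` are `l_(M+1)` and `l⁺_(M+1)`. -/
structure FICNN (n H m : ℕ) where
  posFirst : PosLinearLayer n H
  lin : Fin m → LinearLayer n H
  pos : Fin m → PosLinearLayer H H
  linOut : LinearLayer n 1
  posOut : PosLinearLayer H 1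
  w₀ : ℝ
  w₁ : ℝ

namespace FICNN

variable {n H m : ℕ}

/-- The hidden vectors: `z_1 = l⁺_1(x)` (index `0`) and
`z_k = l_k(x) + l⁺_k(s(z_(k-1)))` for `k = 2, …, M` (indices `1, …, m`). -/
def hidden (N : FICNN n H m) (x : E n) (k : Fin (m + 1)) : Fin H → ℝ :=
  Fin.induction (motive := fun _ => Fin H → ℝ) (N.posFirst.apply x.ofLp)
    (fun k z => (N.lin k).apply x.ofLp + (N.pos k).apply fun j => softplus (z j)) k

/-- `z_(M+1) = l_(M+1)(x) + l⁺_(M+1)(s(z_M))`, a real number. -/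
def output (N : FICNN n H m) (x : E n) : ℝ :=
  N.linOut.apply x.ofLp 0 + N.posOut.apply (fun j => softplus (N.hidden x (Fin.last m) j)) 0

/-- `g(x) = s(w₀) h(x) + s(w₁) ‖x‖² / 2`, where `h(x) = s(z_(M+1))`. -/
def toFun (N : FICNN n H m) (x : E n) : ℝ :=
  softplus N.w₀ * softplus (N.output x) + softplus N.w₁ * (‖x‖ ^ 2 / 2)

end FICNN

/-- `v⁻¹ = ∇g_1 ∘ ∇g_2 ∘ ⋯ ∘ ∇g_B`. -/
def vInv {n H m B : ℕ} (g : Fin B → FICNN n H m) : E n → E n :=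
  (List.ofFn fun i => gradient (g i).toFun).foldr (fun φ ψ => φ ∘ ψ) id

/-- The family of all maps `u ∘ v⁻¹`, over all numbers `B ≥ 1` of networks, all widths `H ≥ 1`, all
numbers `M = m + 1 ≥ 1` of hidden layers and all values of the parameters. -/
def family (n : ℕ) : Set (E n → E n) :=
  {f | (∀ x, f x ∈ projSimplex n) ∧
    ∃ (B H m : ℕ) (g : Fin B → FICNN n H m), 0 < B ∧ 0 < H ∧ softmaxPlus ∘ vInv g = f}

/-- The Hessian matrix: its entry `(i, j)` is the `j`-th partial derivative at `x` of the `i`-th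
component of `∇G`. -/
def hessian {n : ℕ} (G : E n → ℝ) (x : E n) : Matrix (Fin n) (Fin n) ℝ :=
  Matrix.of fun i j => (fderiv ℝ (gradient G) x (EuclideanSpace.single j 1)) i

/-- The functions that are convex and twice differentiable on some convex open set containing `Ω`
(for instance on the whole space), with positive definite Hessian at every point of `Ω`. -/
def convexClass {n : ℕ} (Ω : Set (E n)) : Set (E n → ℝ) :=
  {G | (∃ U : Set (E n), IsOpen U ∧ Convex ℝ U ∧ Ω ⊆ U ∧ ConvexOn ℝ U G ∧
      ∀ x ∈ U, DifferentiableAt ℝ G x ∧ DifferentiableAt ℝ (gradient G) x) ∧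
    ∀ x ∈ Ω, (hessian G x).PosDef}

end LegendreTron

end

/-! On the open simplex `softmaxPlus` is inverted by `logRatio`, and `logRatio` is the gradient of
the convex function `negEntropy`. If `∇G` maps into the open simplex, then `∇G = u ∘ ∇negEntropy ∘
∇G`, so two networks suffice (`B = 2`): one gradient close to `∇negEntropy`, one close to `∇G`
(`exists_mem_family_near`). Values on the boundary of the simplex are first pushed inside by
contracting `∇G` slightly towards the barycentre, which keeps it the gradient of a convex function.

It remains to approximate gradients of convex `C¹` functions on compact sets
(`exists_gradient_near`). For convex functions, uniform closeness of values near a compact set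
forces closeness of gradients (`norm_gradient_sub_le`), so values suffice, and additive constants
are free. On a compact set a convex function is nearly a maximum of finitely many tangents
(`exists_affine_approx`), a maximum is nearly a log-sum-exp at low temperature, and a network of
width one computes log-sum-exp exactly, one affine function per layer (`softplus_logSumExp_sub`). -/

namespace LegendreTron

open Filter Topology

/-! ### Gradients of uniformly close convex functions -/

section ConvexGradient

variable {F : Type*} [NormedAddCommGroup F] [InnerProductSpace ℝ F] [CompleteSpace F]

/-- A convex function lies above its tangent hyperplanes. -/
lemma add_inner_le_of_convexOn {U : Set F} {G : F → ℝ} (hG : ConvexOn ℝ U G) {x y v : F}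
    (hx : x ∈ U) (hy : y ∈ U) (hv : HasGradientAt G v x) :
    G x + inner ℝ v (y - x) ≤ G y := by
  have h0 : AffineMap.lineMap (k := ℝ) x y 0 = x := AffineMap.lineMap_apply_zero x y
  have h1 : AffineMap.lineMap (k := ℝ) x y 1 = y := AffineMap.lineMap_apply_one x y
  have hconv := hG.comp_affineMap (AffineMap.lineMap (k := ℝ) x y)
  have hline : HasDerivAt (AffineMap.lineMap (k := ℝ) x y) (y - x) 0 :=
    AffineMap.hasDerivAt_lineMap
  have hderiv : HasDerivAt (G ∘ AffineMap.lineMap (k := ℝ) x y) (inner ℝ v (y - x)) 0 := by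
    have hv' : HasFDerivAt G (InnerProductSpace.toDual ℝ F v)
        (AffineMap.lineMap (k := ℝ) x y 0) := by
      rw [h0]; exact hv.hasFDerivAt
    simpa using hv'.comp_hasDerivAt (0 : ℝ) hline
  have h := hconv.le_slope_of_hasDerivAt (x := 0) (y := 1) (by simpa [h0] using hx)
    (by simpa [h1] using hy) one_pos hderiv
  simp only [slope_def_field, Function.comp_apply, h0, h1, sub_zero, div_one] at h
  linarith

/-- If two convex functions are close on a ball, and the gradient of one of them varies little
there, then their gradients are close at the centre. -/
lemma norm_gradient_sub_le {U : Set F} {G g : F → ℝ} {G' : F → F} {v x : F} {t η ω : ℝ}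
    (hG : ConvexOn ℝ U G) (hG' : ∀ y ∈ U, HasGradientAt G (G' y) y)
    (hg : ConvexOn ℝ univ g) (hv : HasGradientAt g v x) (ht : 0 < t)
    (hball : Metric.closedBall x t ⊆ U)
    (hclose : ∀ y ∈ Metric.closedBall x t, |g y - G y| ≤ η)
    (hosc : ∀ y ∈ Metric.closedBall x t, ‖G' y - G' x‖ ≤ ω) :
    ‖v - G' x‖ ≤ ω + 2 * η / t := by
  have hxb : x ∈ Metric.closedBall x t := Metric.mem_closedBall_self ht.le
  have hη : 0 ≤ η := (abs_nonneg _).trans (hclose x hxb)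
  have hω : 0 ≤ ω := (norm_nonneg _).trans (hosc x hxb)
  rcases eq_or_ne (v - G' x) 0 with h0 | h0
  · rw [h0, norm_zero]; positivity
  have hpos : 0 < ‖v - G' x‖ := norm_pos_iff.2 h0
  -- Step of length `t` along the gradient error. The tangent of `g` at `x` and that of `G` at `x +
  -- d`, evaluated at each other's base points, bound `⟪v - G' (x + d), d⟫` by `2 * η`.
  set d : F := (t / ‖v - G' x‖) • (v - G' x) with hd
  have hdn : ‖d‖ = t := by
    rw [hd, norm_smul, Real.norm_of_nonneg (by positivity), div_mul_cancel₀ _ hpos.ne']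
  have hyb : x + d ∈ Metric.closedBall x t := by
    simp [hdn]
  have e1 := add_inner_le_of_convexOn hg (mem_univ x) (mem_univ (x + d)) hv
  have e2 := add_inner_le_of_convexOn hG (hball hyb) (hball hxb) (hG' _ (hball hyb))
  have e3 := abs_le.1 (hclose _ hyb)
  have e4 := abs_le.1 (hclose _ hxb)
  have e5 : inner ℝ (v - G' x) d = t * ‖v - G' x‖ := by
    rw [hd, inner_smul_right, real_inner_self_eq_norm_sq]
    field_simp
  have e6 : inner ℝ (G' (x + d) - G' x) d ≤ ω * t :=
    (real_inner_le_norm _ _).trans (by rw [hdn]; gcongr; exact hosc _ hyb)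
  have e7 : x - (x + d) = -d := by abel
  rw [add_sub_cancel_left] at e1
  rw [e7, inner_neg_right] at e2
  rw [inner_sub_left] at e5 e6
  have e8 : t * ‖v - G' x‖ ≤ ω * t + 2 * η := by linarith [e3.2, e4.1]
  have e9 : ω + 2 * η / t = (ω * t + 2 * η) / t := by field_simp
  rw [e9, le_div_iff₀ ht]
  linarith

end ConvexGradient

/-! ### Softplus: monotone, convex, onto the positive reals -/

section Softplus

lemma one_add_exp_pos (t : ℝ) : 0 < 1 + Real.exp t := by positivity

lemma softplus_pos (t : ℝ) : 0 < softplus t :=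
  Real.log_pos (by linarith [Real.exp_pos t])

lemma exp_softplus (t : ℝ) : Real.exp (softplus t) = 1 + Real.exp t :=
  Real.exp_log (one_add_exp_pos t)

lemma exists_softplus_eq {r : ℝ} (hr : 0 < r) : ∃ w, softplus w = r :=
  ⟨Real.log (Real.exp r - 1), by
    rw [softplus, Real.exp_log (by linarith [Real.add_one_lt_exp hr.ne'])]
    simp⟩

lemma softplus_monotone : Monotone softplus := fun _ _ h =>
  Real.log_le_log (one_add_exp_pos _) (by gcongr)

lemma hasDerivAt_softplus (t : ℝ) :
    HasDerivAt softplus (Real.exp t / (1 + Real.exp t)) t :=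
  ((Real.hasDerivAt_exp t).const_add 1).log (one_add_exp_pos t).ne'

lemma differentiable_softplus : Differentiable ℝ softplus := fun t =>
  (hasDerivAt_softplus t).differentiableAt

lemma convexOn_softplus : ConvexOn ℝ univ softplus := by
  refine Monotone.convexOn_univ_of_deriv differentiable_softplus fun a b hab => ?_
  rw [(hasDerivAt_softplus a).deriv, (hasDerivAt_softplus b).deriv,
    div_le_div_iff₀ (one_add_exp_pos a) (one_add_exp_pos b)]
  have := Real.exp_le_exp.2 hab
  nlinarith

lemma convexOn_softplus_comp {F : Type*} [AddCommGroup F] [Module ℝ F] {f : F → ℝ}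
    (hf : ConvexOn ℝ univ f) : ConvexOn ℝ univ fun x => softplus (f x) :=
  ⟨convex_univ, fun _ hx _ hy _ _ ha hb hab =>
    (softplus_monotone (hf.2 hx hy ha hb hab)).trans
      (convexOn_softplus.2 (mem_univ _) (mem_univ _) ha hb hab)⟩

end Softplus

/-! ### Convexity and differentiability of networks -/

section Layers

variable {n p q : ℕ}

lemma LinearLayer.apply_eq (l : LinearLayer p q) (x : Fin p → ℝ) (i : Fin q) :
    l.apply x i = ∑ j, l.weight i j * x j + l.bias i := rfl

lemma LinearLayer.convexOn_apply (l : LinearLayer n q) (i : Fin q) :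
    ConvexOn ℝ univ fun x : E n => l.apply x.ofLp i :=
  ((LinearMap.proj i ∘ₗ l.weight.mulVecLin ∘ₗ
    (WithLp.linearEquiv 2 ℝ (Fin n → ℝ)).toLinearMap).convexOn convex_univ).add_const (l.bias i)

lemma convexOn_sum_mul {F ι : Type*} [AddCommGroup F] [Module ℝ F] (s : Finset ι) {w : ι → ℝ}
    {f : ι → F → ℝ} (hw : ∀ j, 0 ≤ w j) (hf : ∀ j, ConvexOn ℝ univ (f j)) :
    ConvexOn ℝ univ fun x => ∑ j ∈ s, w j * f j x := by
  classical
  induction s using Finset.induction_on with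
  | empty => simpa using convexOn_const (0 : ℝ) (convex_univ (𝕜 := ℝ) (E := F))
  | insert a s ha ih =>
    simp only [Finset.sum_insert ha]
    exact ((hf a).smul (hw a)).add ih

lemma PosLinearLayer.convexOn_apply_comp {F : Type*} [AddCommGroup F] [Module ℝ F]
    (l : PosLinearLayer p q) {f : F → Fin p → ℝ} (hf : ∀ j, ConvexOn ℝ univ fun x => f x j)
    (i : Fin q) : ConvexOn ℝ univ fun x => l.apply (f x) i :=
  (convexOn_sum_mul Finset.univ (fun j => (l.weight_pos i j).le) hf).add_const (l.bias i)

lemma LinearLayer.differentiable_apply_comp {F : Type*} [NormedAddCommGroup F] [NormedSpace ℝ F]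
    (l : LinearLayer p q) {f : F → Fin p → ℝ} (hf : ∀ j, Differentiable ℝ fun x => f x j)
    (i : Fin q) : Differentiable ℝ fun x => l.apply (f x) i := by
  simp only [LinearLayer.apply_eq]
  fun_prop

end Layers

namespace FICNN

variable {n H m : ℕ} (N : FICNN n H m)

@[simp]
lemma hidden_zero (x : E n) : N.hidden x 0 = N.posFirst.apply x.ofLp := rfl

@[simp]
lemma hidden_succ (x : E n) (k : Fin m) :
    N.hidden x k.succ = (N.lin k).apply x.ofLp +
      (N.pos k).apply fun j => softplus (N.hidden x k.castSucc j) := rfl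

lemma convexOn_hidden (k : Fin (m + 1)) :
    ∀ i, ConvexOn ℝ univ fun x => N.hidden x k i := by
  induction k using Fin.induction with
  | zero => exact fun i => N.posFirst.convexOn_apply i
  | succ k ih =>
    exact fun i => ((N.lin k).convexOn_apply i).add
      ((N.pos k).convexOn_apply_comp (fun j => convexOn_softplus_comp (ih j)) i)

lemma differentiable_hidden (k : Fin (m + 1)) :
    ∀ i, Differentiable ℝ fun x => N.hidden x k i := by
  have hx : ∀ j, Differentiable ℝ fun x : E n => x.ofLp j := fun j => by fun_prop
  induction k using Fin.induction with
  | zero => exact fun i => N.posFirst.differentiable_apply_comp hx i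
  | succ k ih =>
    exact fun i => ((N.lin k).differentiable_apply_comp hx i).add
      ((N.pos k).differentiable_apply_comp (fun j => differentiable_softplus.comp (ih j)) i)

lemma convexOn_output : ConvexOn ℝ univ N.output :=
  (N.linOut.convexOn_apply 0).add
    (N.posOut.convexOn_apply_comp (fun j => convexOn_softplus_comp (N.convexOn_hidden _ j)) 0)

lemma differentiable_output : Differentiable ℝ N.output :=
  (N.linOut.differentiable_apply_comp (fun j => by fun_prop) 0).add
    (N.posOut.differentiable_apply_comp
      (fun j => differentiable_softplus.comp (N.differentiable_hidden _ j)) 0)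

lemma convexOn_toFun : ConvexOn ℝ univ N.toFun := by
  refine ((convexOn_softplus_comp N.convexOn_output).smul (softplus_pos _).le).add
    (ConvexOn.smul (softplus_pos _).le ?_)
  have h := ((convexOn_norm (convex_univ (𝕜 := ℝ) (E := E n))).pow
    (fun _ _ => norm_nonneg _) 2).smul (c := (2 : ℝ)⁻¹) (by norm_num)
  refine h.congr fun x _ => ?_
  simp [div_eq_inv_mul]

lemma differentiable_toFun : Differentiable ℝ N.toFun := by
  unfold FICNN.toFun
  have h1 : Differentiable ℝ fun x => softplus (N.output x) :=
    differentiable_softplus.comp N.differentiable_output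
  have h2 : Differentiable ℝ fun x : E n => ‖x‖ ^ 2 := differentiable_id.norm_sq ℝ
  simp only [div_eq_mul_inv]
  exact (h1.const_mul _).add ((h2.mul_const _).const_mul _)

end FICNN

/-! ### Log-sum-exp and its softplus recursion -/

section LogSumExp

/-- The logarithm of `exp (a 0) + ⋯ + exp (a k)`. -/
noncomputable def logSumExp (a : ℕ → ℝ) (k : ℕ) : ℝ :=
  Real.log (∑ i ∈ Finset.range (k + 1), Real.exp (a i))

lemma sum_exp_pos (a : ℕ → ℝ) (k : ℕ) : 0 < ∑ i ∈ Finset.range (k + 1), Real.exp (a i) :=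
  Finset.sum_pos (fun _ _ => Real.exp_pos _) (by simp)

lemma logSumExp_zero (a : ℕ → ℝ) : logSumExp a 0 = a 0 := by simp [logSumExp]

/-- Since `log (e^L + e^a) = a + log (1 + e^(L - a))`, one softplus unit adds one term to a
log-sum-exp. -/
lemma softplus_logSumExp_sub (a : ℕ → ℝ) (k : ℕ) :
    softplus (logSumExp a k - a (k + 1)) = logSumExp a (k + 1) - a (k + 1) := by
  apply Real.exp_injective
  rw [exp_softplus, Real.exp_sub, Real.exp_sub, logSumExp, logSumExp,
    Real.exp_log (sum_exp_pos a k), Real.exp_log (sum_exp_pos a (k + 1)),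
    Finset.sum_range_succ _ (k + 1), add_div, div_self (Real.exp_ne_zero _), add_comm]

lemma le_logSumExp (a : ℕ → ℝ) {i k : ℕ} (hi : i ≤ k) : a i ≤ logSumExp a k := by
  rw [logSumExp, Real.le_log_iff_exp_le (sum_exp_pos a k)]
  exact Finset.single_le_sum (f := fun i => Real.exp (a i)) (fun _ _ => (Real.exp_pos _).le)
    (Finset.mem_range.2 (Nat.lt_succ_of_le hi))

lemma logSumExp_le {a : ℕ → ℝ} {b : ℝ} {k : ℕ} (h : ∀ i ≤ k, a i ≤ b) :
    logSumExp a k ≤ b + Real.log (k + 1) := by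
  have hk : (0 : ℝ) < k + 1 := by positivity
  rw [logSumExp, Real.log_le_iff_le_exp (sum_exp_pos a k), Real.exp_add, Real.exp_log hk]
  calc ∑ i ∈ Finset.range (k + 1), Real.exp (a i)
      ≤ ∑ _i ∈ Finset.range (k + 1), Real.exp b := Finset.sum_le_sum fun i hi =>
        Real.exp_le_exp.2 (h i (Nat.le_of_lt_succ (Finset.mem_range.1 hi)))
    _ = Real.exp b * (k + 1) := by simp [mul_comm]

end LogSumExp

/-! ### Log-sum-exp of affine functions as a width-one network -/

section LogSumExpNetwork

variable {n : ℕ}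

/-- The affine function with slope `α` and constant term `c`. -/
def affineValue (α : Fin n → ℝ) (c : ℝ) (x : E n) : ℝ := ∑ j, α j * x j + c

/-- The network of width one that computes the logarithm of the sum of the exponentials of the
affine functions with slopes `α i` and constant terms `c i`, for `i ≤ m + 2`. -/
def logSumExpNet (α : ℕ → Fin n → ℝ) (c : ℕ → ℝ) (hα : ∀ j, α 1 j < α 0 j) (m : ℕ)
    (w₀ w₁ : ℝ) : FICNN n 1 m where
  posFirst :=
    { weight := fun _ j => α 0 j - α 1 j
      bias := fun _ => c 0 - c 1
      weight_pos := fun _ j => sub_pos.2 (hα j) }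
  lin k :=
    { weight := fun _ j => α (k + 1) j - α (k + 2) j
      bias := fun _ => c (k + 1) - c (k + 2) }
  pos _ :=
    { weight := fun _ _ => 1
      bias := fun _ => 0
      weight_pos := fun _ _ => one_pos }
  linOut :=
    { weight := fun _ j => α (m + 1) j - α (m + 2) j
      bias := fun _ => c (m + 1) - c (m + 2) }
  posOut :=
    { weight := fun _ _ => 1
      bias := fun _ => 0
      weight_pos := fun _ _ => one_pos }
  w₀ := w₀
  w₁ := w₁

variable (α : ℕ → Fin n → ℝ) (c : ℕ → ℝ) (hα : ∀ j, α 1 j < α 0 j) (m : ℕ) (w₀ w₁ : ℝ)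

lemma affineValue_sub (α α' : Fin n → ℝ) (c c' : ℝ) (x : E n) :
    ∑ j, (α j - α' j) * x j + (c - c') = affineValue α c x - affineValue α' c' x := by
  simp only [affineValue, sub_mul, Finset.sum_sub_distrib]
  ring

/-- The recursion leaves `- a (k + 1)` behind after each softplus; the unconstrained affine term `a
(k + 1) - a (k + 2)` of the next layer trades it for the offset needed there. -/
lemma hidden_logSumExpNet (x : E n) (k : Fin (m + 1)) (i : Fin 1) :
    (logSumExpNet α c hα m w₀ w₁).hidden x k i =
      logSumExp (fun i => affineValue (α i) (c i) x) k - affineValue (α (k + 1)) (c (k + 1)) x := by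
  induction k using Fin.induction with
  | zero =>
    simp [logSumExpNet, LinearLayer.apply_eq, logSumExp_zero, affineValue_sub]
  | succ k ih =>
    have hs := softplus_logSumExp_sub (fun i => affineValue (α i) (c i) x) k
    have hi : i = 0 := Subsingleton.elim _ _
    subst hi
    simp only [FICNN.hidden_succ, Pi.add_apply, LinearLayer.apply_eq, Fin.sum_univ_one, ih]
    simp only [logSumExpNet, affineValue_sub, Fin.val_castSucc, hs, Fin.val_succ]
    ring

lemma softplus_output_logSumExpNet (x : E n) :
    softplus ((logSumExpNet α c hα m w₀ w₁).output x) =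
      logSumExp (fun i => affineValue (α i) (c i) x) (m + 2) -
        affineValue (α (m + 2)) (c (m + 2)) x := by
  rw [← softplus_logSumExp_sub]
  congr 1
  have hs := softplus_logSumExp_sub (fun i => affineValue (α i) (c i) x) m
  simp only [FICNN.output, LinearLayer.apply_eq, Fin.sum_univ_one, hidden_logSumExpNet]
  simp only [logSumExpNet, affineValue_sub, Fin.val_last, hs]
  ring

end LogSumExpNetwork

/-! ### Approximation of convex functions and their gradients -/

section Approximation

variable {n : ℕ}

/-- Up to an additive constant, a convex differentiable function is the supremum of finitely many
affine functions on a compact set, up to a small error; the affine functions can be chosen so that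
the first two are comparable and all but finitely many vanish. -/
lemma exists_affine_approx {U K : Set (E n)} {G : E n → ℝ} {G' : E n → E n}
    (hG : ConvexOn ℝ U G) (hG' : ∀ x ∈ U, HasGradientAt G (G' x) x) (hK : IsCompact K)
    (hKU : K ⊆ U) {η : ℝ} (hη : 0 < η) :
    ∃ (C : ℝ) (k : ℕ) (α : ℕ → Fin n → ℝ) (c : ℕ → ℝ), (∀ j, α 1 j < α 0 j) ∧
      (∀ i ≥ k, α i = 0 ∧ c i = 0) ∧
      (∀ x ∈ K, ∀ i, affineValue (α i) (c i) x ≤ G x + C) ∧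
      ∀ x ∈ K, ∃ i < k, G x + C - η ≤ affineValue (α i) (c i) x := by
  have hcont : ∀ x ∈ U, ContinuousAt G x := fun x hx => (hG' x hx).continuousAt
  obtain ⟨C, hC⟩ := hK.exists_bound_of_continuousOn
    (fun x hx => (hcont x (hKU hx)).continuousWithinAt)
  obtain ⟨R, hR⟩ := hK.exists_bound_of_continuousOn (f := fun x : E n => ∑ j, x j)
    (by fun_prop)
  set T : E n → E n → ℝ := fun y x => G y + inner ℝ (G' y) (x - y) with hT
  have hTaff : ∀ y x, T y x + C =
      affineValue (G' y).ofLp (G y - inner ℝ (G' y) y + C) x := by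
    intro y x
    have : inner ℝ (G' y) x = ∑ j, (G' y).ofLp j * x j := by
      simp [PiLp.inner_apply, mul_comm]
    simp only [hT, affineValue, inner_sub_right, ← this]
    ring
  have hnhds : ∀ y ∈ K, {x | G x - η < T y x} ∈ 𝓝 y := by
    intro y hy
    have h1 : ContinuousAt (fun x => G x - η) y := (hcont y (hKU hy)).sub_const η
    have h2 : ContinuousAt (T y) y := by simp only [hT]; fun_prop
    exact h1.eventually_lt h2 (by simp [hT, hη])
  obtain ⟨t, htK, ht⟩ := hK.elim_nhds_subcover _ hnhds
  set P : ℕ → Option (E n) := fun i => t.toList[i]? with hP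
  have hPK : ∀ i y, P i = some y → y ∈ K := fun i y h =>
    htK y (Finset.mem_toList.1 (List.mem_of_getElem? h))
  set A : Option (E n) → (Fin n → ℝ) × ℝ := fun o =>
    o.elim (0, 0) fun y => ((G' y).ofLp, G y - inner ℝ (G' y) y + C) with hA
  -- Entries `0` and `1` serve the first layer, whose weights `α 0 - α 1` must be positive. Both lie
  -- below `G + C` on `K`, since `∑ j, x j ≤ R` and `0 ≤ G + C` there. Tangents follow, then zeros,
  -- which are harmless for the same reason.
  set ℓ : ℕ → (Fin n → ℝ) × ℝ := fun i =>
    match i with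
    | 0 => (fun _ => 1, -R)
    | 1 => (0, 0)
    | i + 2 => A (P i) with hℓ
  have hnonneg : ∀ x ∈ K, 0 ≤ G x + C := fun x hx => by
    have := (abs_le.1 (hC x hx)).1
    linarith
  refine ⟨C, t.card + 2, fun i => (ℓ i).1, fun i => (ℓ i).2, ?_, ?_, ?_, ?_⟩
  · intro j; simp [hℓ]
  · intro i hi
    obtain ⟨i, rfl⟩ := Nat.exists_eq_add_of_le' (show 2 ≤ i by omega)
    have : P i = none := List.getElem?_eq_none (by simpa using hi)
    simp [hℓ, this, hA]
  · intro x hx i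
    match i with
    | 0 =>
      have := (abs_le.1 (hR x hx)).2
      have := hnonneg x hx
      simp only [hℓ, affineValue, one_mul]
      linarith
    | 1 => simpa [hℓ, affineValue] using hnonneg x hx
    | i + 2 =>
      rcases hp : P i with _ | y
      · simpa [hℓ, hp, hA, affineValue] using hnonneg x hx
      · simp only [hℓ, hp, hA, Option.elim, ← hTaff]
        have := add_inner_le_of_convexOn hG (hKU (hPK i y hp)) (hKU hx) (hG' y (hKU (hPK i y hp)))
        simp only [hT]
        linarith
  · intro x hx
    obtain ⟨y, hy, hxy⟩ := mem_iUnion₂.1 (ht hx)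
    obtain ⟨i, hi, hiy⟩ := List.getElem_of_mem (Finset.mem_toList.2 hy)
    have hp : P i = some y := by simp [hP, List.getElem?_eq_getElem hi, hiy]
    refine ⟨i + 2, by simpa using hi, ?_⟩
    simp only [hℓ, hp, hA, Option.elim, ← hTaff]
    have : G x - η < T y x := hxy
    linarith

/-- Every large depth works because the list of affine functions can be padded with zeros; this
later allows two networks to share a depth. -/
lemma exists_toFun_near {U K : Set (E n)} {G : E n → ℝ} {G' : E n → E n}
    (hG : ConvexOn ℝ U G) (hG' : ∀ x ∈ U, HasGradientAt G (G' x) x) (hK : IsCompact K)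
    (hKU : K ⊆ U) {η : ℝ} (hη : 0 < η) :
    ∃ (C : ℝ) (k : ℕ), ∀ m ≥ k, ∃ N : FICNN n 1 m, ∀ x ∈ K, |N.toFun x - (G x + C)| ≤ η := by
  obtain ⟨C, k, α, c, hα, hzero, hle, hge⟩ :=
    exists_affine_approx hG hG' hK hKU (half_pos hη)
  obtain ⟨R, hR⟩ := hK.exists_bound_of_continuousOn (f := fun x : E n => ‖x‖ ^ 2 / 2)
    (by fun_prop)
  refine ⟨C, k, fun m hm => ?_⟩
  have hlog : 0 ≤ Real.log ((m + 2 : ℕ) + 1) :=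
    Real.log_nonneg (by push_cast; linarith [m.cast_nonneg (α := ℝ)])
  -- The temperature: log-sum-exp of `m + 3` terms exceeds their maximum by at most `log (m + 3)`,
  -- which scaling by `b` brings below `η / 2`.
  set b : ℝ := η / 2 / (Real.log ((m + 2 : ℕ) + 1) + 1) with hb
  have hbpos : 0 < b := by positivity
  have hblog : b * Real.log ((m + 2 : ℕ) + 1) ≤ η / 2 := by
    rw [hb, div_mul_eq_mul_div, div_le_iff₀ (by positivity)]
    nlinarith
  -- The quadratic term cannot be switched off, as softplus is positive; it is made at most `η / 2`
  -- on `K`.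
  set ρ : ℝ := η / 2 / (|R| + 1) with hρ
  have hρpos : 0 < ρ := by positivity
  obtain ⟨w₀, hw₀⟩ := exists_softplus_eq hbpos
  obtain ⟨w₁, hw₁⟩ := exists_softplus_eq hρpos
  have hscale : ∀ i x, affineValue (fun j => b⁻¹ * α i j) (b⁻¹ * c i) x =
      b⁻¹ * affineValue (α i) (c i) x := by
    intro i x
    simp only [affineValue, mul_add, Finset.mul_sum, mul_assoc]
  refine ⟨logSumExpNet (fun i j => b⁻¹ * α i j) (fun i => b⁻¹ * c i)
    (fun j => mul_lt_mul_of_pos_left (hα j) (inv_pos.2 hbpos)) m w₀ w₁, fun x hx => ?_⟩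
  -- The network outputs log-sum-exp minus the last affine function, so that one has to be a padding
  -- zero.
  have hlast : affineValue (α (m + 2)) (c (m + 2)) x = 0 := by
    simp [affineValue, hzero (m + 2) (by omega)]
  have hval : (logSumExpNet (fun i j => b⁻¹ * α i j) (fun i => b⁻¹ * c i)
      (fun j => mul_lt_mul_of_pos_left (hα j) (inv_pos.2 hbpos)) m w₀ w₁).toFun x =
      b * logSumExp (fun i => b⁻¹ * affineValue (α i) (c i) x) (m + 2) + ρ * (‖x‖ ^ 2 / 2) := by
    rw [FICNN.toFun, softplus_output_logSumExpNet]
    simp only [hscale, hlast]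
    simp [logSumExpNet, hw₀, hw₁]
  have hquad : ρ * (‖x‖ ^ 2 / 2) ≤ η / 2 := by
    have h1 := (le_abs_self _).trans ((hR x hx).trans (le_abs_self R))
    rw [hρ, div_mul_eq_mul_div, div_le_iff₀ (by positivity)]
    nlinarith
  have hquad' : 0 ≤ ρ * (‖x‖ ^ 2 / 2) := by positivity
  have hup : b * logSumExp (fun i => b⁻¹ * affineValue (α i) (c i) x) (m + 2) ≤
      G x + C + η / 2 := by
    have h1 := logSumExp_le (k := m + 2) (b := b⁻¹ * (G x + C))
      (a := fun i => b⁻¹ * affineValue (α i) (c i) x)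
      fun i _ => mul_le_mul_of_nonneg_left (hle x hx i) (inv_pos.2 hbpos).le
    have h2 := mul_le_mul_of_nonneg_left h1 hbpos.le
    rw [mul_add, mul_inv_cancel_left₀ hbpos.ne'] at h2
    linarith
  have hlow : G x + C - η / 2 ≤
      b * logSumExp (fun i => b⁻¹ * affineValue (α i) (c i) x) (m + 2) := by
    obtain ⟨i, hi, hix⟩ := hge x hx
    have h1 := le_logSumExp (fun i => b⁻¹ * affineValue (α i) (c i) x)
      (show i ≤ m + 2 by omega)
    have h2 := mul_le_mul_of_nonneg_left h1 hbpos.le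
    rw [mul_inv_cancel_left₀ hbpos.ne'] at h2
    linarith
  rw [hval, abs_le]
  constructor <;> linarith

/-- On compact sets, the gradients of networks of width one and of any sufficiently large depth
approximate the gradient of a convex continuously differentiable function. -/
theorem exists_gradient_near {U K : Set (E n)} {G : E n → ℝ} {G' : E n → E n} (hU : IsOpen U)
    (hG : ConvexOn ℝ U G) (hG' : ∀ x ∈ U, HasGradientAt G (G' x) x) (hcont : ContinuousOn G' U)
    (hK : IsCompact K) (hKU : K ⊆ U) {ε : ℝ} (hε : 0 < ε) :
    ∃ k : ℕ, ∀ m ≥ k, ∃ N : FICNN n 1 m, ∀ x ∈ K, ‖gradient N.toFun x - G' x‖ < ε := by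
  obtain ⟨δ, hδ, hδU⟩ := hK.exists_cthickening_subset_open hU hKU
  -- Only one of the two compared points has to lie in `K`.
  have hunif := hK.uniformContinuousAt_of_continuousAt G'
    (fun x hx => hcont.continuousAt (hU.mem_nhds (hKU hx)))
    (Metric.dist_mem_uniformity (ε := ε / 3) (by positivity))
  obtain ⟨r, hr, hrG⟩ := Metric.mem_uniformity_dist.1 hunif
  set t : ℝ := min δ (r / 2) with ht
  have htpos : 0 < t := lt_min hδ (half_pos hr)
  -- With value error `t * ε / 6` and oscillation `ε / 3` on balls of radius `t`, the gradient error
  -- is at most `2 * ε / 3`.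
  obtain ⟨C, k, hk⟩ := exists_toFun_near hG hG' (hK.cthickening (r := δ)) hδU
    (η := t * ε / 6) (by positivity)
  refine ⟨k, fun m hm => ?_⟩
  obtain ⟨N, hN⟩ := hk m hm
  refine ⟨N, fun x hx => ?_⟩
  have hball : Metric.closedBall x t ⊆ Metric.cthickening δ K :=
    (Metric.closedBall_subset_closedBall (min_le_left _ _)).trans
      (Metric.closedBall_subset_cthickening hx δ)
  have h := norm_gradient_sub_le (G := fun y => G y + C) (G' := G') (ω := ε / 3)
    (hG.add_const C) (fun y hy => ?_) N.convexOn_toFun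
    (N.differentiable_toFun x).hasGradientAt htpos (hball.trans hδU)
    (fun y hy => hN y (hball hy)) (fun y hy => ?_)
  · have e : 2 * (t * ε / 6) / t = ε / 3 := by field_simp; norm_num
    rw [e] at h
    linarith
  · rw [hasGradientAt_iff_hasFDerivAt]
    exact (hG' y hy).hasFDerivAt.add_const C
  · have hy' : dist x y < r := by
      rw [dist_comm]
      have := Metric.mem_closedBall.1 hy
      have := min_le_right δ (r / 2)
      linarith
    have := hrG hy' hx
    rw [← dist_eq_norm, dist_comm]
    exact le_of_lt this

end Approximation

/-! ### Softmax and negative entropy on the open simplex -/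

section Softmax

variable {n : ℕ}

lemma one_add_sum_exp_pos (x : E n) : 0 < 1 + ∑ k, Real.exp (x k) := by positivity

lemma softmaxPlus_apply (x : E n) (i : Fin n) :
    softmaxPlus x i = Real.exp (x i) / (1 + ∑ k, Real.exp (x k)) := rfl

lemma softmaxPlus_mem (x : E n) : softmaxPlus x ∈ projSimplex n := by
  have h := one_add_sum_exp_pos x
  refine ⟨fun i => div_nonneg (Real.exp_pos _).le h.le, ?_⟩
  simp only [softmaxPlus_apply, ← Finset.sum_div]
  rw [div_le_one h]
  linarith

lemma continuous_softmaxPlus : Continuous (softmaxPlus (n := n)) := by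
  refine (PiLp.continuous_toLp 2 _).comp (continuous_pi fun i => ?_)
  exact Continuous.div (by fun_prop) (by fun_prop) fun x => (one_add_sum_exp_pos x).ne'

/-- The interior of the projected simplex. -/
def openSimplex (n : ℕ) : Set (E n) := {p | (∀ i, 0 < p i) ∧ ∑ i, p i < 1}

lemma isOpen_openSimplex : IsOpen (openSimplex n) := by
  have h : openSimplex n = (⋂ i, {p : E n | 0 < p i}) ∩ {p | ∑ i, p i < 1} := by
    ext p; simp [openSimplex]
  rw [h]
  exact (isOpen_iInter_of_finite fun i => isOpen_lt (by fun_prop) (by fun_prop)).inter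
    (isOpen_lt (by fun_prop) (by fun_prop))

lemma convex_openSimplex : Convex ℝ (openSimplex n) := by
  have h : openSimplex n = (⋂ i, {p : E n | 0 < EuclideanSpace.proj (𝕜 := ℝ) i p}) ∩
      {p | (∑ i, EuclideanSpace.proj (𝕜 := ℝ) i : E n →L[ℝ] ℝ) p < 1} := by
    ext p; simp [openSimplex]
  rw [h]
  exact (convex_iInter fun i =>
    convex_halfSpace_gt (EuclideanSpace.proj (𝕜 := ℝ) i).toLinearMap.isLinear 0).inter
    (convex_halfSpace_lt (∑ i, EuclideanSpace.proj (𝕜 := ℝ) i : E n →L[ℝ] ℝ).toLinearMap.isLinear 1)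

/-- The negative entropy of the distribution with masses `p i` and `1 - ∑ p i`. -/
noncomputable def negEntropy (p : E n) : ℝ :=
  ∑ i, p i * Real.log (p i) + (1 - ∑ i, p i) * Real.log (1 - ∑ i, p i)

/-- The inverse of `softmaxPlus` on the interior of the simplex. -/
noncomputable def logRatio (p : E n) : E n :=
  WithLp.toLp 2 fun i => Real.log (p i) - Real.log (1 - ∑ k, p k)

lemma softmaxPlus_logRatio {p : E n} (hp : p ∈ openSimplex n) : softmaxPlus (logRatio p) = p := by
  have h0 : 0 < 1 - ∑ k, p k := by linarith [hp.2]
  have hexp : ∀ i, Real.exp (logRatio p i) = p i / (1 - ∑ k, p k) := fun i => by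
    rw [logRatio, Real.exp_sub, Real.exp_log (hp.1 i), Real.exp_log h0]
  ext i
  simp only [softmaxPlus_apply, hexp, ← Finset.sum_div]
  field_simp
  ring

lemma continuousOn_logRatio : ContinuousOn (logRatio (n := n)) (openSimplex n) := by
  refine (PiLp.continuous_toLp 2 _).comp_continuousOn (continuousOn_pi.2 fun i => ?_)
  refine ContinuousOn.sub (ContinuousOn.log (by fun_prop) fun p hp => (hp.1 i).ne')
    (ContinuousOn.log (by fun_prop) fun p hp => ?_)
  have := hp.2
  linarith

lemma convexOn_negEntropy : ConvexOn ℝ (openSimplex n) (negEntropy (n := n)) := by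
  have hterm : ∀ L : E n →ᵃ[ℝ] ℝ, (∀ p ∈ openSimplex n, 0 ≤ L p) →
      ConvexOn ℝ (openSimplex n) fun p => L p * Real.log (L p) := fun L hL =>
    (Real.convexOn_mul_log.comp_affineMap L).subset (fun p hp => hL p hp) convex_openSimplex
  have hsum : ConvexOn ℝ (openSimplex n) fun p : E n => ∑ i, p i * Real.log (p i) := by
    have h : ∀ s : Finset (Fin n),
        ConvexOn ℝ (openSimplex n) fun p : E n => ∑ i ∈ s, p i * Real.log (p i) := by
      intro s
      induction s using Finset.induction_on with
      | empty => simpa using convexOn_const (0 : ℝ) convex_openSimplex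
      | insert a s ha ih =>
        simp only [Finset.sum_insert ha]
        exact (hterm (EuclideanSpace.proj (𝕜 := ℝ) a).toLinearMap.toAffineMap
          fun p hp => (hp.1 a).le).add ih
    exact h _
  have hlast := hterm (AffineMap.const ℝ (E n) 1 -
    (∑ i, EuclideanSpace.proj (𝕜 := ℝ) i : E n →L[ℝ] ℝ).toLinearMap.toAffineMap) fun p hp => by
      simpa using hp.2.le
  refine (hsum.add hlast).congr fun p _ => ?_
  simp [negEntropy]

/-- The derivative of `t * log t` is `log t + 1`; the `1` from `p i` cancels against the one from
the remaining mass `1 - ∑ p i`. -/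
lemma hasGradientAt_negEntropy {p : E n} (hp : p ∈ openSimplex n) :
    HasGradientAt negEntropy (logRatio p) p := by
  have h0 : 1 - ∑ k, p k ≠ 0 := by linarith [hp.2]
  have hproj : ∀ i, HasFDerivAt (fun q : E n => q i) (EuclideanSpace.proj (𝕜 := ℝ) i) p := fun i =>
    (EuclideanSpace.proj (𝕜 := ℝ) i : E n →L[ℝ] ℝ).hasFDerivAt
  have hrest : HasFDerivAt (fun q : E n => 1 - ∑ i, q i)
      (-∑ i, EuclideanSpace.proj (𝕜 := ℝ) i) p :=
    (HasFDerivAt.fun_sum fun i _ => hproj i).const_sub 1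
  have hterm : ∀ i, HasFDerivAt (fun q : E n => q i * Real.log (q i))
      ((Real.log (p i) + 1) • EuclideanSpace.proj (𝕜 := ℝ) i) p := fun i =>
    HasDerivAt.comp_hasFDerivAt (h₂ := fun t => t * Real.log t) p
      (Real.hasDerivAt_mul_log (hp.1 i).ne') (hproj i)
  have hlast := (Real.hasDerivAt_mul_log h0).comp_hasFDerivAt p hrest
  rw [hasGradientAt_iff_hasFDerivAt]
  refine ((HasFDerivAt.fun_sum fun i (_ : i ∈ Finset.univ) => hterm i).add hlast).congr_fderiv ?_
  ext v
  simp only [add_apply, sum_apply,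
    smul_apply, neg_apply, PiLp.proj_apply,
    smul_eq_mul, InnerProductSpace.toDual_apply_apply, PiLp.inner_apply, logRatio,
    RCLike.inner_apply, conj_trivial, mul_neg, Finset.mul_sum]
  rw [← sub_eq_add_neg, ← Finset.sum_sub_distrib]
  exact Finset.sum_congr rfl fun i _ => by ring

end Softmax

/-! ### Contracting gradients into the open simplex -/

section Contraction

variable {n : ℕ}

/-- The barycentre of the projected simplex. -/
noncomputable def barycentre (n : ℕ) : E n := WithLp.toLp 2 fun _ => ((n : ℝ) + 1)⁻¹

lemma barycentre_mem : barycentre n ∈ openSimplex n := by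
  refine ⟨fun i => by simp only [barycentre]; positivity, ?_⟩
  simp only [barycentre, Finset.sum_const, Finset.card_univ, Fintype.card_fin, nsmul_eq_mul]
  rw [← div_eq_mul_inv, div_lt_one (by positivity)]
  linarith

lemma add_smul_mem_openSimplex {p c : E n} {δ : ℝ} (hp : p ∈ projSimplex n)
    (hc : c ∈ openSimplex n) (h0 : 0 < δ) (h1 : δ ≤ 1) :
    (1 - δ) • p + δ • c ∈ openSimplex n := by
  have h2 : 0 ≤ 1 - δ := sub_nonneg.2 h1
  refine ⟨fun i => ?_, ?_⟩
  · have := mul_nonneg h2 (hp.1 i)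
    have := mul_pos h0 (hc.1 i)
    simp only [PiLp.add_apply, PiLp.smul_apply, smul_eq_mul]
    linarith
  · simp only [PiLp.add_apply, PiLp.smul_apply, smul_eq_mul, Finset.sum_add_distrib,
      ← Finset.mul_sum]
    have := mul_le_mul_of_nonneg_left hp.2 h2
    have := mul_lt_mul_of_pos_left hc.2 h0
    linarith

/-- With `a = 1 - δ` and `b = δ`, this is the potential whose gradient is `∇G` contracted towards
`c`. -/
lemma convexOn_mul_add_inner {U : Set (E n)} {G : E n → ℝ} (hG : ConvexOn ℝ U G) {a : ℝ}
    (ha : 0 ≤ a) (b : ℝ) (c : E n) : ConvexOn ℝ U fun y => a * G y + b * inner ℝ c y :=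
  (hG.smul ha).add ((b • (innerₗ (E n) c)).convexOn hG.1)

lemma hasGradientAt_mul_add_inner {G : E n → ℝ} {v x : E n} (hG : HasGradientAt G v x) (a b : ℝ)
    (c : E n) : HasGradientAt (fun y => a * G y + b * inner ℝ c y) (a • v + b • c) x := by
  have hinner : HasFDerivAt (fun y => inner ℝ c y) (InnerProductSpace.toDual ℝ (E n) c) x :=
    (InnerProductSpace.toDual ℝ (E n) c).hasFDerivAt
  rw [hasGradientAt_iff_hasFDerivAt, map_add]
  refine ((hG.hasFDerivAt.const_mul a).add (hinner.const_mul b)).congr_fderiv ?_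
  simp

end Contraction

lemma vInv_pair {n H m : ℕ} (g₁ g₂ : FICNN n H m) :
    vInv ![g₁, g₂] = gradient g₁.toFun ∘ gradient g₂.toFun := by
  simp [vInv, List.ofFn_succ]

/-- A gradient of a convex continuously differentiable function with values in the interior of the
simplex is approximated by members of the family. -/
theorem exists_mem_family_near {n : ℕ} {U Ω : Set (E n)} {G : E n → ℝ} {G' : E n → E n}
    (hU : IsOpen U) (hG : ConvexOn ℝ U G) (hG' : ∀ x ∈ U, HasGradientAt G (G' x) x)
    (hcont : ContinuousOn G' U) (hΩ : IsCompact Ω) (hΩU : Ω ⊆ U)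
    (hrange : ∀ x ∈ Ω, G' x ∈ openSimplex n) {ε : ℝ} (hε : 0 < ε) :
    ∃ f ∈ family n, ∀ x ∈ Ω, ‖f x - G' x‖ < ε := by
  have hP : IsCompact (G' '' Ω) := hΩ.image_of_continuousOn (hcont.mono hΩU)
  -- Room for the inner network: an `r`-approximation of `G'` on `Ω` stays in a compact subset of
  -- the open simplex, where the outer network is accurate.
  obtain ⟨r, hr, hrV⟩ := hP.exists_cthickening_subset_open isOpen_openSimplex
    (image_subset_iff.2 hrange)
  have hK : IsCompact (Metric.cthickening r (G' '' Ω)) := hP.cthickening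
  have hunif := (hK.image_of_continuousOn
    (continuousOn_logRatio.mono hrV)).uniformContinuousAt_of_continuousAt softmaxPlus (fun x _ =>
      continuous_softmaxPlus.continuousAt) (Metric.dist_mem_uniformity (half_pos hε))
  obtain ⟨η, hη, hηu⟩ := Metric.mem_uniformity_dist.1 hunif
  obtain ⟨k₁, hk₁⟩ := exists_gradient_near isOpen_openSimplex convexOn_negEntropy
    (fun p hp => hasGradientAt_negEntropy hp) continuousOn_logRatio hK hrV hη
  obtain ⟨k₂, hk₂⟩ := exists_gradient_near hU hG hG' hcont hΩ hΩU
    (lt_min hr (half_pos hε))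
  -- Members of `family` are built from networks of one common depth.
  obtain ⟨N₁, hN₁⟩ := hk₁ (max k₁ k₂) (le_max_left _ _)
  obtain ⟨N₂, hN₂⟩ := hk₂ (max k₁ k₂) (le_max_right _ _)
  refine ⟨softmaxPlus ∘ vInv ![N₁, N₂],
    ⟨fun x => softmaxPlus_mem _, 2, 1, _, ![N₁, N₂], two_pos, one_pos, rfl⟩, fun x hx => ?_⟩
  rw [vInv_pair]
  set q := gradient N₂.toFun x with hq
  have hqx : ‖q - G' x‖ < min r (ε / 2) := hN₂ x hx
  have hqK : q ∈ Metric.cthickening r (G' '' Ω) :=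
    Metric.closedBall_subset_cthickening (mem_image_of_mem G' hx) r
      (mem_closedBall_iff_norm.2 (hqx.le.trans (min_le_left _ _)))
  have hu : dist (softmaxPlus (logRatio q)) (softmaxPlus (gradient N₁.toFun q)) < ε / 2 :=
    hηu (by rw [dist_comm, dist_eq_norm]; exact hN₁ q hqK) (mem_image_of_mem _ hqK)
  rw [softmaxPlus_logRatio (hrV hqK), dist_comm, dist_eq_norm] at hu
  calc ‖softmaxPlus (gradient N₁.toFun q) - G' x‖
      ≤ ‖softmaxPlus (gradient N₁.toFun q) - q‖ + ‖q - G' x‖ :=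
        norm_sub_le_norm_sub_add_norm_sub _ _ _
    _ < ε / 2 + ε / 2 := add_lt_add hu (hqx.trans_le (min_le_right _ _))
    _ = ε := add_halves ε

end LegendreTron

theorem mainTheorem4 (n : ℕ) (Ω : Set (LegendreTron.E n)) (hΩ : IsCompact Ω)
    (G : LegendreTron.E n → ℝ) (hG : G ∈ LegendreTron.convexClass Ω)
    (hGrange : ∀ x ∈ Ω, gradient G x ∈ LegendreTron.projSimplex n)
    (ε : ℝ) (hε : 0 < ε) :
    ∃ f ∈ LegendreTron.family n, ∀ x ∈ Ω, ‖f x - gradient G x‖ < ε := by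
  obtain ⟨⟨U, hU, -, hΩU, hconv, hdiff⟩, -⟩ := hG
  -- Twice differentiability enters through continuity of the gradient.
  have hcont : ContinuousOn (gradient G) U := fun x hx =>
    (hdiff x hx).2.continuousAt.continuousWithinAt
  obtain ⟨c, hc⟩ : ∃ c, c ∈ LegendreTron.openSimplex n := ⟨_, LegendreTron.barycentre_mem⟩
  obtain ⟨R, hR⟩ := hΩ.exists_bound_of_continuousOn (f := fun x => c - gradient G x)
    (continuousOn_const.sub (hcont.mono hΩU))
  -- The contraction moves the gradient by `δ * ‖c - gradient G x‖`, at most `δ * |R|` on `Ω`.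
  obtain ⟨δ, hδpos, hδ1, hδR⟩ : ∃ δ : ℝ, 0 < δ ∧ δ ≤ 1 ∧ δ * |R| ≤ ε / 2 := by
    refine ⟨min 1 (ε / 2 / (|R| + 1)), lt_min one_pos (by positivity), min_le_left _ _, ?_⟩
    have hpos : 0 < |R| + 1 := by positivity
    calc min 1 (ε / 2 / (|R| + 1)) * |R|
        ≤ ε / 2 / (|R| + 1) * (|R| + 1) := by
          gcongr
          · exact min_le_right _ _
          · linarith
      _ = ε / 2 := div_mul_cancel₀ _ hpos.ne'
  have hgrad : ∀ x ∈ U, HasGradientAt (fun y => (1 - δ) * G y + δ * inner ℝ c y)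
      ((1 - δ) • gradient G x + δ • c) x := fun x hx =>
    LegendreTron.hasGradientAt_mul_add_inner (hdiff x hx).1.hasGradientAt _ _ _
  have hcont' : ContinuousOn (fun x => (1 - δ) • gradient G x + δ • c) U :=
    by fun_prop
  have hrange : ∀ x ∈ Ω, (1 - δ) • gradient G x + δ • c ∈ LegendreTron.openSimplex n := fun x hx =>
    LegendreTron.add_smul_mem_openSimplex (hGrange x hx) hc hδpos hδ1
  obtain ⟨f, hf, hfx⟩ := LegendreTron.exists_mem_family_near hU
    (LegendreTron.convexOn_mul_add_inner hconv (sub_nonneg.2 hδ1) δ c) hgrad hcont' hΩ hΩU hrange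
    (half_pos hε)
  refine ⟨f, hf, fun x hx => ?_⟩
  have e1 : (1 - δ) • gradient G x + δ • c - gradient G x = δ • (c - gradient G x) := by
    module
  have e2 : ‖(1 - δ) • gradient G x + δ • c - gradient G x‖ ≤ ε / 2 := by
    rw [e1, norm_smul, Real.norm_of_nonneg hδpos.le]
    exact (mul_le_mul_of_nonneg_left ((hR x hx).trans (le_abs_self R)) hδpos.le).trans hδR
  calc ‖f x - gradient G x‖
      ≤ ‖f x - ((1 - δ) • gradient G x + δ • c)‖ +
          ‖(1 - δ) • gradient G x + δ • c - gradient G x‖ :=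
        norm_sub_le_norm_sub_add_norm_sub _ _ _
    _ < ε / 2 + ε / 2 := add_lt_add_of_lt_of_le (hfx x hx) e2
    _ = ε := add_halves ε
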